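/- Let $I\subset\mathbb R$ be an interval. For $n\ge 1$ let $W_n=\{\lambda\in\mathbb R^n:\lambda_i\ge 0,\ \sum_i\lambda_i>0\}$ and $W_n^0=\{\lambda\in\mathbb R^n:\lambda_1>0,\ \lambda_2,\dots,\lambda_n\ge0\}$. A *weighted mean* on $I$ is a function $\mathscr M:\bigcup_{n\ge1} I^n\times W_n\to I$ such that for all $n\ge 1$, $x\in I^n$, $\lambda,\mu\in W_n$: (i) $\mathscr M(x,t\lambda)=\mathscr M(x,\lambda)$ for all $t>0$; (ii) $\mathscr M(x,\lambda+\mu)=\mathscr M\big((x_1,x_1,\dots,x_n,x_n),(\lambda_1,\mu_1,\dots,\lambda_n,\mu_n)\big)$; (iii) $\min_i x_i\le\mathscr M(x,\lambda)\le\max_i x_i$; (iv) entries with zero weight can be omitted, that is, if $\lambda_j=0$, then deleting $x_j$ and $\lambda_j$ does not change the value of $\mathscr M(x,\lambda)$. It is *symmetric* if $\mathscr M(x\circ\sigma,\lambda\circ\sigma)=\mathscr M(x,\lambda)$ for all permutations $\sigma$ of $\{1,\dots,n\}$, *Jensen concave* if $\mathscr M(\frac{x+y}2,\lambda)\ge\frac12(\mathscr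 M(x,\lambda)+\mathscr M(y,\lambda))$ for all $x,y\in I^n$, $\lambda\in W_n$, and *continuous in the weights* if $\lambda\mapsto\mathscr M(x,\lambda)$ is continuous on $W_n$ for all $n$ and $x\in I^n$. Let $\mathscr A(x,\lambda)=\sum_i\lambda_ix_i/\sum_i\lambda_i$. For $\lambda\in W_n^0$ we say that $\mathscr M$ satisfies the *$(n,\lambda)$-Kedlaya inequality* if for all $x\in I^n$, with $x^{(k)}=(x_1,\dots,x_k)$, $\lambda^{(k)}=(\lambda_1,\dots,\lambda_k)$, $$\mathscr A\Big(\big(\mathscr M(x^{(k)},\lambda^{(k)})\big)_{k=1}^n,\lambda\Big)\le \mathscr M\Big(\big(\mathscr A(x^{(k)},\lambda^{(k)})\big)_{k=1}^n,\lambda\Big).$$ Let $WR_n=WR_n(I)$ be the set of all $\lambda\in W_n^0$ such that every symmetric, Jensen concave weighted mean on $I$ that is continuous in the weights satisfies the $(n,\lambda)$-Kedlaya inequality. Let $E:I\times I\to\mathbb R$ be a deviation function: $E(x,x)=0$ for all $x\in I$, and for each $x\in I$ the function $E(x,\cdot)$ is continuous and strictly decreasing on $I$. For $x\in I^n$, $\lambda\in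 W_n$ let $\mathscr D_E(x,\lambda)$ be the unique $y\in I$ with $\lambda_1E(x_1,y)+\dots+\lambda_nE(x_n,y)=0$. **Proposition.** Suppose that $E$ is differentiable on $I$ with respect to its second variable (one-sidedly at endpoints belonging to $I$), that $\partial_2E(t,t)\ne0$ for all $t\in I$, and that $E^*(x,t)=-\dfrac{E(x,t)}{\partial_2E(t,t)}$ is Jensen concave on $I^2$, i.e. $E^*\big(\frac{x+y}2,\frac{s+t}2\big)\ge\frac12\big(E^*(x,s)+E^*(y,t)\big)$ for all $x,y,s,t\in I$. Then $\mathscr D_E$ satisfies the $(n,\lambda)$-Kedlaya inequality for all $n\ge1$ and all $\lambda\in WR_n$. -/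

import Mathlib

namespace WeightedKedlaya

/-- Data of a function of `n` entries and `n` real weights, for every `n`.  Only its values at entries
in a given interval and at weight vectors in `W n` are ever used; other values are irrelevant. -/
abbrev MeanFamily : Type := (n : ℕ) → (Fin n → ℝ) → (Fin n → ℝ) → ℝ

/-- `W_n(ℝ)`: nonnegative weight vectors with positive sum (empty for `n = 0`). -/
def W (n : ℕ) : Set (Fin n → ℝ) := {w | (∀ i, 0 ≤ w i) ∧ 0 < ∑ i, w i}

/-- `W_n^0(ℝ)`: nonnegative weight vectors whose first member is positive (`n ≥ 1`). -/
def W0 (n : ℕ) : Set (Fin n → ℝ) := {w | (∃ h : 0 < n, 0 < w ⟨0, h⟩) ∧ ∀ i, 0 ≤ w i}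

/-- The shuffle `(p₁, q₁, p₂, q₂, …, pₙ, qₙ)`. -/
def shuffle {n : ℕ} (p q : Fin n → ℝ) : Fin (2 * n) → ℝ := fun i =>
  if i.val % 2 = 0 then p ⟨i.val / 2, by omega⟩ else q ⟨i.val / 2, by omega⟩

/-- `M` is an `ℝ`-weighted mean on `I`. -/
structure IsWeightedMean (I : Set ℝ) (M : MeanFamily) : Prop where
  mem : ∀ (n : ℕ) (x w : Fin n → ℝ), (∀ i, x i ∈ I) → w ∈ W n → M n x w ∈ I
  nullhomogeneous : ∀ (n : ℕ) (x w : Fin n → ℝ) (t : ℝ), (∀ i, x i ∈ I) → w ∈ W n → 0 < t →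
    M n x w = M n x (t • w)
  reduction : ∀ (n : ℕ) (x w v : Fin n → ℝ), (∀ i, x i ∈ I) → w ∈ W n → v ∈ W n →
    M n x (w + v) = M (2 * n) (shuffle x x) (shuffle w v)
  mean_value : ∀ (n : ℕ) (x w : Fin n → ℝ), (∀ i, x i ∈ I) → w ∈ W n →
    (⨅ i, x i) ≤ M n x w ∧ M n x w ≤ ⨆ i, x i
  elimination : ∀ (n : ℕ) (x w : Fin (n + 1) → ℝ) (j : Fin (n + 1)), (∀ i, x i ∈ I) →
    w ∈ W (n + 1) → w j = 0 →
    M (n + 1) x w = M n (fun i => x (j.succAbove i)) (fun i => w (j.succAbove i))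

/-- Symmetry of a weighted mean. -/
def IsSymmetricMean (I : Set ℝ) (M : MeanFamily) : Prop :=
  ∀ (n : ℕ) (x w : Fin n → ℝ) (σ : Equiv.Perm (Fin n)), (∀ i, x i ∈ I) → w ∈ W n →
    M n x w = M n (x ∘ σ) (w ∘ σ)

/-- Jensen concavity of a weighted mean (in the entries, for fixed weights). -/
def IsJensenConcaveMean (I : Set ℝ) (M : MeanFamily) : Prop :=
  ∀ (n : ℕ) (x y w : Fin n → ℝ), (∀ i, x i ∈ I) → (∀ i, y i ∈ I) → w ∈ W n →
    (1 / 2 : ℝ) * (M n x w + M n y w) ≤ M n (fun i => (x i + y i) / 2) w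

/-- Continuity in the weights. -/
def IsContinuousInWeights (I : Set ℝ) (M : MeanFamily) : Prop :=
  ∀ (n : ℕ) (x : Fin n → ℝ), (∀ i, x i ∈ I) → ContinuousOn (fun w => M n x w) (W n)

/-- The weighted arithmetic mean. -/
noncomputable def arith : MeanFamily := fun _ x w => (∑ i, w i * x i) / ∑ i, w i

/-- The initial segment of length `k + 1` of a vector of length `n`; here `k : Fin n` counts from
zero. -/
def initSeg {n : ℕ} (x : Fin n → ℝ) (k : Fin n) : Fin (k.val + 1) → ℝ :=
  fun i => x (Fin.castLE k.isLt i)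

/-- The `n` variable `w`-weighted Kedlaya inequality for `M` on `I`. -/
def SatisfiesKedlaya (I : Set ℝ) (M : MeanFamily) (n : ℕ) (w : Fin n → ℝ) : Prop :=
  ∀ x : Fin n → ℝ, (∀ i, x i ∈ I) →
    arith n (fun k => M (k.val + 1) (initSeg x k) (initSeg w k)) w ≤
      M n (fun k => arith (k.val + 1) (initSeg x k) (initSeg w k)) w

/-- The weight vectors in `W_n^0(ℝ)` for which every symmetric, Jensen concave `ℝ`-weighted mean on
`I` that is continuous in the weights satisfies the Kedlaya inequality. -/
def WR (I : Set ℝ) (n : ℕ) : Set (Fin n → ℝ) :=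
  {w | w ∈ W0 n ∧ ∀ M : MeanFamily, IsWeightedMean I M → IsSymmetricMean I M →
    IsJensenConcaveMean I M → IsContinuousInWeights I M → SatisfiesKedlaya I M n w}

/-- `E` is a deviation function on `I × I`. -/
structure IsDeviation (I : Set ℝ) (E : ℝ → ℝ → ℝ) : Prop where
  diag : ∀ x ∈ I, E x x = 0
  cont : ∀ x ∈ I, ContinuousOn (E x) I
  anti : ∀ x ∈ I, StrictAntiOn (E x) I

/-- The weighted deviation (Daróczy) mean: the solution `y ∈ I` of `∑ wᵢ E(xᵢ, y) = 0`, which exists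
and is unique by `existsUnique_deviation` below. -/
noncomputable def deviationMean (I : Set ℝ) (E : ℝ → ℝ → ℝ) : MeanFamily := fun _ x w =>
  Classical.epsilon fun y : ℝ => y ∈ I ∧ ∑ i, w i * E (x i) y = 0

/-- `∂₂E(t,t)`, one-sided at an endpoint of `I` that belongs to `I`. -/
noncomputable def diagDeriv (I : Set ℝ) (E : ℝ → ℝ → ℝ) (t : ℝ) : ℝ := derivWithin (E t) I t

/-- `E*(x,t) = -E(x,t)/∂₂E(t,t)`. -/
noncomputable def starFun (I : Set ℝ) (E : ℝ → ℝ → ℝ) (x t : ℝ) : ℝ := -(E x t / diagDeriv I E t)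

/-- Jensen concavity of a function of two variables on `I × I`. -/
def IsJensenConcave₂ (I : Set ℝ) (F : ℝ → ℝ → ℝ) : Prop :=
  ∀ x ∈ I, ∀ y ∈ I, ∀ s ∈ I, ∀ t ∈ I,
    (1 / 2 : ℝ) * (F x s + F y t) ≤ F ((x + y) / 2) ((s + t) / 2)

/-- The equation that defines the weighted deviation mean has exactly one solution in `I`. -/
theorem existsUnique_deviation {I : Set ℝ} (hI : I.OrdConnected) {E : ℝ → ℝ → ℝ}
    (hE : IsDeviation I E) {n : ℕ} {x w : Fin n → ℝ} (hx : ∀ i, x i ∈ I) (hw : w ∈ W n) :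
    ∃! y : ℝ, y ∈ I ∧ ∑ i, w i * E (x i) y = 0 := by
  have hne : ∃ i, 0 < w i := by
    by_contra! h
    exact absurd hw.2 (not_lt.mpr (Finset.sum_nonpos fun i _ => h i))
  obtain ⟨k, hk⟩ := hne
  have : Nonempty (Fin n) := ⟨k⟩
  have hanti : StrictAntiOn (fun y => ∑ i, w i * E (x i) y) I := by
    intro a ha b hb hab
    refine Finset.sum_lt_sum (fun i _ => ?_) ⟨k, Finset.mem_univ k, ?_⟩
    · exact mul_le_mul_of_nonneg_left ((hE.anti _ (hx i)).antitoneOn ha hb hab.le) (hw.1 i)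
    · exact mul_lt_mul_of_pos_left ((hE.anti _ (hx k)) ha hb hab) hk
  obtain ⟨a, ha⟩ := Finite.exists_min x
  obtain ⟨b, hb⟩ := Finite.exists_max x
  have hsub : Set.Icc (x a) (x b) ⊆ I := hI.out (hx a) (hx b)
  have hcont : ContinuousOn (fun y => ∑ i, w i * E (x i) y) (Set.Icc (x a) (x b)) :=
    continuousOn_finsetSum _ fun i _ => continuousOn_const.mul ((hE.cont _ (hx i)).mono hsub)
  have h0 : (0 : ℝ) ∈ Set.Icc (∑ i, w i * E (x i) (x b)) (∑ i, w i * E (x i) (x a)) := by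
    constructor
    · refine Finset.sum_nonpos fun i _ => mul_nonpos_of_nonneg_of_nonpos (hw.1 i) ?_
      exact ((hE.anti _ (hx i)).antitoneOn (hx i) (hx b) (hb i)).trans_eq (hE.diag _ (hx i))
    · refine Finset.sum_nonneg fun i _ => mul_nonneg (hw.1 i) ?_
      exact (hE.diag _ (hx i)).symm.trans_le
        ((hE.anti _ (hx i)).antitoneOn (hx a) (hx i) (ha i))
  obtain ⟨y, hy, hy0⟩ := intermediate_value_Icc' (ha b) hcont h0
  refine ⟨y, ⟨hsub hy, hy0⟩, fun z hz => ?_⟩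
  exact hanti.injOn hz.1 (hsub hy) (hz.2.trans hy0.symm)

/-- The weighted deviation mean is a point of `I` and solves its defining equation. -/
theorem deviationMean_spec {I : Set ℝ} (hI : I.OrdConnected) {E : ℝ → ℝ → ℝ}
    (hE : IsDeviation I E) {n : ℕ} {x w : Fin n → ℝ} (hx : ∀ i, x i ∈ I) (hw : w ∈ W n) :
    deviationMean I E n x w ∈ I ∧ ∑ i, w i * E (x i) (deviationMean I E n x w) = 0 :=
  Classical.epsilon_spec (existsUnique_deviation hI hE hx hw).exists

end WeightedKedlaya

open WeightedKedlaya

namespace WeightedKedlaya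

variable {I : Set ℝ} {E : ℝ → ℝ → ℝ}

/-! A weight vector in `WR I n` gives the inequality for every admissible mean, so it is enough that
the deviation mean is admissible. Everything is read off from the sum `y ↦ ∑ wᵢ E(xᵢ, y)`, strictly
decreasing with its zero at the mean: equalities of means follow from uniqueness of the zero, and
bounds from its sign (`le_deviationMean_iff`, `deviationMean_le_iff`). Only Jensen concavity uses
`E*`: normalizing by `-∂₂E(t,t) > 0` keeps the sign of the sum, and concavity of `E*` makes it
nonnegative at the midpoint of two means. -/

theorem strictAntiOn_weightedSum (hE : IsDeviation I E) {n : ℕ} {x w : Fin n → ℝ}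
    (hx : ∀ i, x i ∈ I) (hw : w ∈ W n) : StrictAntiOn (fun y => ∑ i, w i * E (x i) y) I := by
  obtain ⟨k, hk⟩ : ∃ i, 0 < w i := by
    by_contra! h
    exact absurd hw.2 (not_lt.mpr (Finset.sum_nonpos fun i _ => h i))
  intro a ha b hb hab
  exact Finset.sum_lt_sum
    (fun i _ => mul_le_mul_of_nonneg_left ((hE.anti _ (hx i)).antitoneOn ha hb hab.le) (hw.1 i))
    ⟨k, Finset.mem_univ k, mul_lt_mul_of_pos_left ((hE.anti _ (hx k)) ha hb hab) hk⟩

theorem deviationMean_eq (hI : I.OrdConnected) (hE : IsDeviation I E) {n : ℕ} {x w : Fin n → ℝ}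
    (hx : ∀ i, x i ∈ I) (hw : w ∈ W n) {y : ℝ} (hy : y ∈ I) (h : ∑ i, w i * E (x i) y = 0) :
    deviationMean I E n x w = y :=
  (existsUnique_deviation hI hE hx hw).unique (deviationMean_spec hI hE hx hw) ⟨hy, h⟩

theorem le_deviationMean_iff (hI : I.OrdConnected) (hE : IsDeviation I E) {n : ℕ}
    {x w : Fin n → ℝ} (hx : ∀ i, x i ∈ I) (hw : w ∈ W n) {y : ℝ} (hy : y ∈ I) :
    y ≤ deviationMean I E n x w ↔ 0 ≤ ∑ i, w i * E (x i) y := by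
  have hs := deviationMean_spec hI hE hx hw
  have h := (strictAntiOn_weightedSum hE hx hw).le_iff_ge hs.1 hy
  simp only [hs.2] at h
  exact h.symm

theorem deviationMean_le_iff (hI : I.OrdConnected) (hE : IsDeviation I E) {n : ℕ}
    {x w : Fin n → ℝ} (hx : ∀ i, x i ∈ I) (hw : w ∈ W n) {y : ℝ} (hy : y ∈ I) :
    deviationMean I E n x w ≤ y ↔ ∑ i, w i * E (x i) y ≤ 0 := by
  have hs := deviationMean_spec hI hE hx hw
  have h := (strictAntiOn_weightedSum hE hx hw).le_iff_ge hy hs.1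
  simp only [hs.2] at h
  exact h.symm

theorem sum_shuffle {n : ℕ} (p q r s : Fin n → ℝ) (f : ℝ → ℝ → ℝ) :
    ∑ i, f (shuffle p q i) (shuffle r s i) = ∑ i, (f (p i) (r i) + f (q i) (s i)) := by
  -- Reindex by pairs `(a, b)` with `b ∈ {0, 1}`, matched to position `b + 2 * a`; the parity `b`
  -- selects the vector.
  rw [← (finProdFinEquiv.trans (finCongr (mul_comm n 2))).sum_comp, Fintype.sum_prod_type]
  refine Finset.sum_congr rfl fun i _ => ?_
  have h : (1 + 2 * (i : ℕ)) / 2 = i := by omega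
  simp [Fin.sum_univ_two, shuffle, finProdFinEquiv, h]

theorem shuffle_forall {n : ℕ} {p q : Fin n → ℝ} {P : ℝ → Prop} (hp : ∀ i, P (p i))
    (hq : ∀ i, P (q i)) (i : Fin (2 * n)) : P (shuffle p q i) := by
  unfold shuffle
  split_ifs
  · exact hp _
  · exact hq _

theorem add_mem_W {n : ℕ} {w v : Fin n → ℝ} (hw : w ∈ W n) (hv : v ∈ W n) : w + v ∈ W n :=
  ⟨fun i => add_nonneg (hw.1 i) (hv.1 i), by
    simpa [Finset.sum_add_distrib] using add_pos hw.2 hv.2⟩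

theorem shuffle_mem_W {n : ℕ} {w v : Fin n → ℝ} (hw : w ∈ W n) (hv : v ∈ W n) :
    shuffle w v ∈ W (2 * n) := by
  refine ⟨shuffle_forall (P := fun a => 0 ≤ a) hw.1 hv.1, ?_⟩
  rw [sum_shuffle w v w v fun a _ => a]
  exact (add_mem_W hw hv).2

theorem smul_mem_W {n : ℕ} {w : Fin n → ℝ} (hw : w ∈ W n) {t : ℝ} (ht : 0 < t) : t • w ∈ W n :=
  ⟨fun i => mul_nonneg ht.le (hw.1 i), by
    simpa [← Finset.mul_sum] using mul_pos ht hw.2⟩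

theorem comp_perm_mem_W {n : ℕ} {w : Fin n → ℝ} (hw : w ∈ W n) (σ : Equiv.Perm (Fin n)) :
    w ∘ σ ∈ W n :=
  ⟨fun i => hw.1 (σ i), (Equiv.sum_comp σ w).symm ▸ hw.2⟩

theorem succAbove_mem_W {n : ℕ} {w : Fin (n + 1) → ℝ} (hw : w ∈ W (n + 1)) {j : Fin (n + 1)}
    (hj : w j = 0) : (fun i => w (j.succAbove i)) ∈ W n :=
  ⟨fun i => hw.1 _, by simpa [Fin.sum_univ_succAbove w j, hj] using hw.2⟩

theorem isWeightedMean_deviationMean (hI : I.OrdConnected) (hE : IsDeviation I E) :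
    IsWeightedMean I (deviationMean I E) where
  mem n x w hx hw := (deviationMean_spec hI hE hx hw).1
  nullhomogeneous n x w t hx hw ht := by
    obtain ⟨hmem, h0⟩ := deviationMean_spec hI hE hx hw
    refine (deviationMean_eq hI hE hx (smul_mem_W hw ht) hmem ?_).symm
    simp only [Pi.smul_apply, smul_eq_mul, mul_assoc, ← Finset.mul_sum, h0, mul_zero]
  reduction n x w v hx hw hv := by
    obtain ⟨hmem, h0⟩ := deviationMean_spec hI hE hx (add_mem_W hw hv)
    refine (deviationMean_eq hI hE (shuffle_forall (P := (· ∈ I)) hx hx) (shuffle_mem_W hw hv)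
      hmem ?_).symm
    rw [sum_shuffle w v x x fun a b => a * E b (deviationMean I E n x (w + v)), ← h0]
    simp only [Pi.add_apply, add_mul]
  mean_value n x w hx hw := by
    have : Nonempty (Fin n) := by
      by_contra h
      rw [not_nonempty_iff] at h
      simpa using hw.2
    obtain ⟨a, ha⟩ := Finite.exists_min x
    obtain ⟨b, hb⟩ := Finite.exists_max x
    constructor
    · refine (ciInf_le (Set.finite_range x).bddBelow a).trans
        ((le_deviationMean_iff hI hE hx hw (hx a)).2 ?_)
      exact Finset.sum_nonneg fun i _ => mul_nonneg (hw.1 i) ((hE.diag _ (hx i)).symm.trans_le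
        ((hE.anti _ (hx i)).antitoneOn (hx a) (hx i) (ha i)))
    · refine ((deviationMean_le_iff hI hE hx hw (hx b)).2 ?_).trans
        (le_ciSup (Set.finite_range x).bddAbove b)
      exact Finset.sum_nonpos fun i _ => mul_nonpos_of_nonneg_of_nonpos (hw.1 i)
        (((hE.anti _ (hx i)).antitoneOn (hx i) (hx b) (hb i)).trans_eq (hE.diag _ (hx i)))
  elimination n x w j hx hw hj := by
    obtain ⟨hmem, h0⟩ := deviationMean_spec hI hE hx hw
    refine (deviationMean_eq hI hE (fun i => hx _) (succAbove_mem_W hw hj) hmem ?_).symm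
    simpa [Fin.sum_univ_succAbove _ j, hj] using h0

theorem isSymmetricMean_deviationMean (hI : I.OrdConnected) (hE : IsDeviation I E) :
    IsSymmetricMean I (deviationMean I E) := by
  intro n x w σ hx hw
  obtain ⟨hmem, h0⟩ := deviationMean_spec hI hE hx hw
  exact (deviationMean_eq hI hE (fun i => hx (σ i)) (comp_perm_mem_W hw σ) hmem
    ((Equiv.sum_comp σ fun i => w i * E (x i) (deviationMean I E n x w)).trans h0)).symm

/-- At a fixed point the defining sum is linear in the weights, so a strict sign persists under
small changes, and with it a strict bound on the mean. -/
theorem isContinuousInWeights_deviationMean (hI : I.OrdConnected) (hE : IsDeviation I E) :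
    IsContinuousInWeights I (deviationMean I E) := by
  intro n x hx w hw
  have hcont (y : ℝ) : Continuous fun v : Fin n → ℝ => ∑ i, v i * E (x i) y := by fun_prop
  have hmem := (deviationMean_spec hI hE hx hw).1
  refine tendsto_order.2 ⟨fun a ha => ?_, fun a ha => ?_⟩
  · by_cases haI : a ∈ I
    · have h := lt_of_not_ge (mt (deviationMean_le_iff hI hE hx hw haI).2 (not_le.2 ha))
      filter_upwards [self_mem_nhdsWithin,
        (hcont a).continuousWithinAt.eventually (lt_mem_nhds h)] with v hv hv0
      exact lt_of_not_ge (mt (deviationMean_le_iff hI hE hx hv haI).1 (not_le.2 hv0))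
    -- No sign test is available at `a ∉ I`, but a mean on the other side of `a` would put `a`
    -- between two points of `I`.
    · filter_upwards [self_mem_nhdsWithin] with v hv
      by_contra! hle
      exact haI (hI.out (deviationMean_spec hI hE hx hv).1 hmem ⟨hle, ha.le⟩)
  · by_cases haI : a ∈ I
    · have h := lt_of_not_ge (mt (le_deviationMean_iff hI hE hx hw haI).2 (not_le.2 ha))
      filter_upwards [self_mem_nhdsWithin,
        (hcont a).continuousWithinAt.eventually (gt_mem_nhds h)] with v hv hv0
      exact lt_of_not_ge (mt (le_deviationMean_iff hI hE hx hv haI).1 (not_le.2 hv0))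
    · filter_upwards [self_mem_nhdsWithin] with v hv
      by_contra! hle
      exact haI (hI.out hmem (deviationMean_spec hI hE hx hv).1 ⟨ha.le, hle⟩)

theorem diagDeriv_nonpos (hE : IsDeviation I E) {t : ℝ} (ht : t ∈ I) : diagDeriv I E t ≤ 0 :=
  (hE.anti t ht).antitoneOn.derivWithin_nonpos

/-- The normalizing factor depends on `t` alone, so it leaves the sum. -/
theorem sum_mul_starFun {n : ℕ} (x w : Fin n → ℝ) (t : ℝ) :
    ∑ i, w i * starFun I E (x i) t = (∑ i, w i * E (x i) t) / -diagDeriv I E t := by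
  rw [Finset.sum_div]
  refine Finset.sum_congr rfl fun i _ => ?_
  rw [starFun, div_neg, mul_neg, mul_div_assoc]

theorem isJensenConcaveMean_deviationMean (hI : I.OrdConnected) (hE : IsDeviation I E)
    (hne : ∀ t ∈ I, diagDeriv I E t ≠ 0) (hstar : IsJensenConcave₂ I (starFun I E)) :
    IsJensenConcaveMean I (deviationMean I E) := by
  intro n x y w hx hy hw
  have hmid {a b : ℝ} (ha : a ∈ I) (hb : b ∈ I) : (a + b) / 2 ∈ I := by
    have h : (1 / 2 : ℝ) • a + (1 / 2 : ℝ) • b ∈ I :=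
      hI.convex ha hb (by norm_num) (by norm_num) (by norm_num)
    rwa [← smul_add, smul_eq_mul, one_div, inv_mul_eq_div] at h
  obtain ⟨hs, hs0⟩ := deviationMean_spec hI hE hx hw
  obtain ⟨ht, ht0⟩ := deviationMean_spec hI hE hy hw
  set s := deviationMean I E n x w
  set t := deviationMean I E n y w
  have hst := hmid hs ht
  have hpos : 0 < -diagDeriv I E ((s + t) / 2) :=
    neg_pos.2 ((diagDeriv_nonpos hE hst).lt_of_ne (hne _ hst))
  have hsum : 0 ≤ ∑ i, w i * starFun I E ((x i + y i) / 2) ((s + t) / 2) := by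
    -- Both `E*` sums vanish, since `s` and `t` are the zeros of the corresponding `E` sums.
    calc (0 : ℝ) = 1 / 2 * (∑ i, w i * starFun I E (x i) s + ∑ i, w i * starFun I E (y i) t) := by
          rw [sum_mul_starFun, sum_mul_starFun, hs0, ht0]; simp
      _ = ∑ i, w i * (1 / 2 * (starFun I E (x i) s + starFun I E (y i) t)) := by
          rw [← Finset.sum_add_distrib, Finset.mul_sum]
          exact Finset.sum_congr rfl fun i _ => by ring
      _ ≤ _ := Finset.sum_le_sum fun i _ =>
          mul_le_mul_of_nonneg_left (hstar _ (hx i) _ (hy i) _ hs _ ht) (hw.1 i)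
  rw [sum_mul_starFun (fun i => (x i + y i) / 2), le_div_iff₀ hpos, zero_mul] at hsum
  rw [one_div, inv_mul_eq_div]
  exact (le_deviationMean_iff hI hE (fun i => hmid (hx i) (hy i)) hw hst).2 hsum

end WeightedKedlaya

open WeightedKedlaya
theorem proposition4p2 (I : Set ℝ) (hI : I.OrdConnected) (E : ℝ → ℝ → ℝ) (hE : IsDeviation I E)
    (hdiff : ∀ x ∈ I, DifferentiableOn ℝ (E x) I)
    (hne : ∀ t ∈ I, diagDeriv I E t ≠ 0)
    (hstar : IsJensenConcave₂ I (starFun I E)) :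
    ∀ n : ℕ, 1 ≤ n → ∀ w ∈ WR I n, SatisfiesKedlaya I (deviationMean I E) n w :=
  fun _ _ _ hw => hw.2 _ (isWeightedMean_deviationMean hI hE) (isSymmetricMean_deviationMean hI hE)
    (isJensenConcaveMean_deviationMean hI hE hne hstar)
    (isContinuousInWeights_deviationMean hI hE)
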